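/- Let $k\ge 3$, $g\ge 2$ and $s\ge 1$ be integers. For a finite hypergraph $\mathcal G=(V,E)$ let $\mathcal A_{\mathcal G}$ be its adjacency matrix, indexed by $V$, with $(\mathcal A_{\mathcal G})_{ij}=\sum_{e\in E,\ i,j\in e}\frac{1}{|e|-1}$ for $i\neq j$ and $(\mathcal A_{\mathcal G})_{ii}=0$; let $\rho(\mathcal G)$ be the maximum modulus of an eigenvalue of $\mathcal A_{\mathcal G}$. Let $\mathcal C_g$ be the $k$-uniform hypercycle with $g$ edges $e_1,\dots,e_g$, where $e_i=\{v_i,v_{a(i,1)},\dots,v_{a(i,k-2)},v_{i+1}\}$ for $1\le i\le g$, with $v_{g+1}=v_1$, and where the $g+g(k-2)$ vertices $v_i$, $v_{a(i,j)}$ ($1\le i\le g$, $1\le j\le k-2$) are distinct. Attaching a pendant hyperpath of length $s$ at a vertex $u_0$ means adding $s$ new edges $f_1,\dots,f_s$, where $f_t$ consists of $u_{t-1}$, $u_t$ and $k-2$ further vertices, and $u_1,\dots,u_s$ and all these further vertices are new and pairwise distinct. Let $Lop_{g,k,s;1}$ (respectively $Lop_{g,k,s;2}$) be the hypergraph obtained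 from $\mathcal C_g$ by attaching a pendant hyperpath of length $s$ at $v_1$ (respectively at $v_{a(1,1)}$). Then $$(1)\quad \rho(Lop_{g+1,k,s;1})<\rho(Lop_{g,k,s;1}),\qquad (2)\quad \rho(Lop_{g+1,k,s;2})<\rho(Lop_{g,k,s;2}).$$ -/

import Mathlib

namespace Hypergraph

/-- The adjacency matrix of a hypergraph, indexed by its vertex set: for distinct vertices `i`, `j`
the entry is `∑ 1 / (|e| - 1)` over the edges `e` containing both, and diagonal entries are `0`.
The entries are real; they are taken in `ℂ` so that all eigenvalues are seen by the spectrum. -/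
noncomputable def adjacencyMatrix {α : Type*} (H : Hypergraph α) :
    Matrix H.vertexSet H.vertexSet ℂ :=
  open Classical in
  Matrix.of fun i j =>
    if i = j then 0
    else ∑ᶠ e ∈ {e : Set α | e ∈ H.edgeSet ∧ (i : α) ∈ e ∧ (j : α) ∈ e},
      1 / ((e.ncard : ℂ) - 1)

/-- The spectral radius of a hypergraph with finitely many vertices: the largest modulus of an
eigenvalue of its adjacency matrix. -/
noncomputable def rho {α : Type*} (H : Hypergraph α) [Finite H.vertexSet] : ENNReal :=
  open Classical in
  letI : Fintype H.vertexSet := Fintype.ofFinite _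
  spectralRadius ℂ H.adjacencyMatrix

/-- Vertices of the hypercycle of length `g` (zero-based): `Sum.inl i` is the junction vertex `v_i`,
and `Sum.inr (i, j)` is the `j`-th interior vertex of the edge joining `v_i` to its successor. -/
abbrev CycleVertex (g k : ℕ) : Type := Fin g ⊕ Fin g × Fin (k - 2)

/-- The cyclic successor on `Fin g`. -/
def cyclicSucc {g : ℕ} (i : Fin g) : Fin g := ⟨(i.val + 1) % g, Nat.mod_lt _ i.pos⟩

/-- The `i`-th edge of the `k`-uniform hypercycle: `v_i`, `v_{i+1}` (cyclically) and the `k - 2`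
interior vertices of that edge. -/
def cycleEdge (g k : ℕ) (i : Fin g) : Set (CycleVertex g k) :=
  {Sum.inl i, Sum.inl (cyclicSucc i)} ∪ Set.range fun j : Fin (k - 2) => Sum.inr (i, j)

/-- The `k`-uniform hypercycle of length `g` (for `g ≥ 2`, `k ≥ 3`). -/
def hypercycle (g k : ℕ) : Hypergraph (CycleVertex g k) where
  vertexSet := Set.univ
  edgeSet := Set.range (cycleEdge g k)
  subset_vertexSet_of_mem_edgeSet' := fun _ _ => Set.subset_univ _

theorem mem_vertexSet_hypercycle (g k : ℕ) (x : CycleVertex g k) :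
    x ∈ (hypercycle g k).vertexSet := Set.mem_univ x

/-- Vertices after attaching a hyperpath with `s` edges to a hypergraph on `α`: the old vertices
(`Sum.inl`), for each path edge `t : Fin s` its far junction vertex (`Sum.inr (Sum.inl t)`), and
its `k - 2` interior vertices (`Sum.inr (Sum.inr (t, j))`). -/
abbrev AttachVertex (α : Type*) (k s : ℕ) : Type _ := α ⊕ (Fin s ⊕ Fin s × Fin (k - 2))

/-- The near junction vertex of the path edge `t`: the attaching vertex `x` for the first edge, and
the far junction vertex of the preceding edge otherwise. -/
def pathStart {α : Type*} (x : α) (k : ℕ) {s : ℕ} (t : Fin s) : AttachVertex α k s :=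
  if t.val = 0 then Sum.inl x
  else Sum.inr (Sum.inl ⟨t.val - 1, lt_of_le_of_lt (Nat.sub_le _ _) t.isLt⟩)

/-- The path edge `t`: its near and far junction vertices and its `k - 2` interior vertices. -/
def pathEdge {α : Type*} (x : α) (k : ℕ) {s : ℕ} (t : Fin s) : Set (AttachVertex α k s) :=
  {pathStart x k t, Sum.inr (Sum.inl t)} ∪
    Set.range fun j : Fin (k - 2) => Sum.inr (Sum.inr (t, j))

/-- The hypergraph obtained from `H` by attaching a pendant `k`-uniform hyperpath of length `s`
(all of whose vertices other than `x` are new) at the vertex `x` of `H`. -/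
def attachHyperpath {α : Type*} (H : Hypergraph α) (x : α) (hx : x ∈ H.vertexSet) (k s : ℕ) :
    Hypergraph (AttachVertex α k s) where
  vertexSet := Sum.inl '' H.vertexSet ∪ Set.range Sum.inr
  edgeSet := (fun e => Sum.inl '' e) '' H.edgeSet ∪ Set.range (pathEdge x k)
  subset_vertexSet_of_mem_edgeSet' := by
    rintro e (⟨e, he, rfl⟩ | ⟨t, rfl⟩)
    · exact (Set.image_mono (H.subset_vertexSet_of_mem_edgeSet' he)).trans Set.subset_union_left
    · rintro _ ((rfl | rfl) | ⟨j, rfl⟩)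
      · unfold pathStart
        split_ifs
        · exact Or.inl ⟨x, hx, rfl⟩
        · exact Or.inr ⟨_, rfl⟩
      · exact Or.inr ⟨_, rfl⟩
      · exact Or.inr ⟨_, rfl⟩

/-- The first type lollipop `Lop_{g,k,s;1}`: a pendant hyperpath of length `s` is attached to the
`k`-uniform hypercycle of length `g` at a junction vertex. -/
def lollipop₁ (g k s : ℕ) (hg : 2 ≤ g) : Hypergraph (AttachVertex (CycleVertex g k) k s) :=
  (hypercycle g k).attachHyperpath (Sum.inl ⟨0, by omega⟩) (mem_vertexSet_hypercycle g k _) k s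

/-- The second type lollipop `Lop_{g,k,s;2}`: a pendant hyperpath of length `s` is attached to the
`k`-uniform hypercycle of length `g` at an interior (degree one) vertex of an edge. -/
def lollipop₂ (g k s : ℕ) (hg : 2 ≤ g) (hk : 3 ≤ k) :
    Hypergraph (AttachVertex (CycleVertex g k) k s) :=
  (hypercycle g k).attachHyperpath (Sum.inr (⟨0, by omega⟩, ⟨0, by omega⟩)) (mem_vertexSet_hypercycle g k _) k s

end Hypergraph

/-! Let `x` be the Perron vector of the longer lollipop, with eigenvalue `ρ`, and put `r = (k -
1)ρ`. On the cycle, `x` is governed by its junction values `X i` and edge sums `S i`. Eliminating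
interior vertices leaves `(r + 2) X i = S i + S (i - 1)` and `β S i = X i + X (i + 1)`, where `β = 1
- (k - 2)/(r + 1)`; the hyperpath enters only as a source at index `o`, in the first equation (type
1) or the second (type 2).

Summing round the cycle gives `4 < β (r + 2)` (`four_lt_of_cyclic_source`), so a minimum of `X`
occurs at some `m ≠ o` (`exists_ne_forall_le_of_cyclic_source`). Delete `m`, merge its two edges,
and give the merged edge the sum dictated by the same relation. Minimality of `X m` makes this sum
at least both old ones, and strictly larger than one of them (`le_of_delete_min`,
`lt_of_delete_min`). The resulting positive vector on the shorter lollipop is therefore subinvariant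
for `ρ`, strictly at some junction; pairing it with the Perron vector there
(`Matrix.IsSymm.lt_of_subinvariant`) gives the strict inequality. -/

/-! ### Perron-Frobenius theory for symmetric nonnegative matrices -/

section PerronFrobenius

open Matrix

variable {V : Type*} [Fintype V]

/-- A symmetric real matrix on a nonempty index type has a nonzero maximiser of the Rayleigh quotient
with nonnegative entries, if its own entries are nonnegative; it is an eigenvector. -/
theorem Matrix.IsSymm.exists_nonneg_eigenvector [DecidableEq V] [Nonempty V] {A : Matrix V V ℝ} (hA : A.IsSymm)
    (h0 : ∀ i j, 0 ≤ A i j) :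
    ∃ (x : V → ℝ) (r : ℝ), (∀ i, 0 ≤ x i) ∧ x ≠ 0 ∧ A *ᵥ x = r • x := by
  set T := Matrix.toEuclideanCLM (𝕜 := ℝ) (n := V) A with hT
  have hsa : IsSelfAdjoint T := by
    have : IsSelfAdjoint A := by
      rw [IsSelfAdjoint, Matrix.star_eq_conjTranspose, Matrix.conjTranspose_eq_transpose_of_trivial]
      exact hA
    exact this.map _
  have hq : ∀ y : EuclideanSpace ℝ V, T.reApplyInnerSelf y = ∑ i, y i * ∑ j, A i j * y j := by
    intro y
    rw [ContinuousLinearMap.reApplyInnerSelf_apply]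
    simp [PiLp.inner_apply, hT, Matrix.mulVec, dotProduct]
  obtain ⟨z, hz, hmax⟩ := (isCompact_sphere (0 : EuclideanSpace ℝ V) 1).exists_isMaxOn
    (NormedSpace.sphere_nonempty.2 zero_le_one) T.reApplyInnerSelf_continuous.continuousOn
  -- Taking absolute values keeps the norm and, as `A` is entrywise nonnegative, does not lower the
  -- quadratic form, so `y` is again a maximiser.
  let y : EuclideanSpace ℝ V := WithLp.toLp 2 fun i => |z i|
  have hy : ‖y‖ = 1 := by
    rw [← mem_sphere_zero_iff_norm.1 hz, EuclideanSpace.norm_eq, EuclideanSpace.norm_eq]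
    simp [y]
  have hy0 : y ≠ 0 := by
    intro h; simp [h] at hy
  have hmaxy : IsMaxOn T.reApplyInnerSelf (Metric.sphere 0 ‖y‖) y := by
    rw [hy]
    intro u hu
    refine le_trans (isMaxOn_iff.1 hmax u hu) ?_
    change T.reApplyInnerSelf z ≤ T.reApplyInnerSelf y
    simp only [hq, Finset.mul_sum]
    refine Finset.sum_le_sum fun i _ => Finset.sum_le_sum fun j _ => ?_
    calc z i * (A i j * z j) ≤ |z i * (A i j * z j)| := le_abs_self _
      _ = y i * (A i j * y j) := by
        simp [y, abs_mul, abs_of_nonneg (h0 i j)]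
  have hev := (hsa.hasEigenvector_of_isMaxOn hy0 hmaxy).apply_eq_smul
  refine ⟨fun i => |z i|, ⨆ x : {x : EuclideanSpace ℝ V // x ≠ 0}, T.rayleighQuotient x, fun i => abs_nonneg _, fun h => hy0 ?_, ?_⟩
  · ext i; simpa [y] using congrFun h i
  · exact congrArg WithLp.ofLp hev

/-- The existence part of the Perron-Frobenius theorem for symmetric matrices. -/
theorem Matrix.IsSymm.exists_pos_eigenvector [DecidableEq V] [Nonempty V] {A : Matrix V V ℝ} (hA : A.IsSymm)
    (h0 : ∀ i j, 0 ≤ A i j) (hirr : ∀ i j, Relation.ReflTransGen (fun i j => 0 < A i j) i j) :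
    ∃ (x : V → ℝ) (r : ℝ), (∀ i, 0 < x i) ∧ A *ᵥ x = r • x := by
  obtain ⟨x, r, hx, hx0, h⟩ := hA.exists_nonneg_eigenvector h0
  refine ⟨x, r, fun i => (hx i).lt_of_ne' fun hi => hx0 ?_, h⟩
  funext j
  induction hirr i j with
  | refl => exact hi
  | @tail b c _ hbc ih =>
    have hb := congrFun h b
    simp only [Matrix.mulVec, dotProduct, Pi.smul_apply, ih, Pi.zero_apply, smul_zero] at hb
    have := (Finset.sum_eq_zero_iff_of_nonneg fun l _ => mul_nonneg (h0 b l) (hx l)).1 hb c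
      (Finset.mem_univ c)
    exact (mul_eq_zero.1 this).resolve_left hbc.ne'

/-- A vector with nonnegative entries that is strictly subinvariant for `μ` bounds the eigenvalue of
a positive eigenvector from below. -/
theorem Matrix.IsSymm.lt_of_subinvariant {A : Matrix V V ℝ} (hA : A.IsSymm) {x y : V → ℝ}
    {r μ : ℝ} (hx : ∀ i, 0 < x i) (h : A *ᵥ x = r • x) (hy0 : ∀ i, 0 < y i)
    (hy : ∀ i, μ * y i ≤ (A *ᵥ y) i) {i₀ : V} (hi₀ : μ * y i₀ < (A *ᵥ y) i₀) : μ < r := by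
  have h1 : x ⬝ᵥ (A *ᵥ y) = r * (x ⬝ᵥ y) := by
    rw [Matrix.dotProduct_mulVec, ← Matrix.mulVec_transpose, hA.eq, h, smul_dotProduct, smul_eq_mul]
  have h2 : μ * (x ⬝ᵥ y) < x ⬝ᵥ (A *ᵥ y) := by
    rw [dotProduct, dotProduct, Finset.mul_sum]
    refine Finset.sum_lt_sum (fun i _ => ?_) ⟨i₀, Finset.mem_univ _, ?_⟩
    · nlinarith [mul_le_mul_of_nonneg_left (hy i) (hx i).le]
    · nlinarith [mul_lt_mul_of_pos_left hi₀ (hx i₀)]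
  have h3 : 0 < x ⬝ᵥ y := Finset.sum_pos (fun i _ => mul_pos (hx i) (hy0 i)) ⟨i₀, Finset.mem_univ _⟩
  rw [h1] at h2
  exact lt_of_mul_lt_mul_right h2 h3.le

/-- The spectral radius of a symmetric nonnegative matrix is the eigenvalue of a positive
eigenvector. -/
theorem Matrix.IsSymm.spectralRadius_eq [DecidableEq V] [Nonempty V] {A : Matrix V V ℝ} (hA : A.IsSymm)
    (h0 : ∀ i j, 0 ≤ A i j) {x : V → ℝ} {r : ℝ} (hx : ∀ i, 0 < x i) (h : A *ᵥ x = r • x) :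
    spectralRadius ℂ (A.map ((↑) : ℝ → ℂ)) = ENNReal.ofReal r := by
  have hr : 0 ≤ r := by
    obtain ⟨i⟩ := ‹Nonempty V›
    have := congrFun h i
    have h' : 0 ≤ (A *ᵥ x) i := Finset.sum_nonneg fun j _ => mul_nonneg (h0 i j) (hx j).le
    rw [this] at h'
    exact nonneg_of_mul_nonneg_left h' (hx i)
  apply le_antisymm
  · refine iSup₂_le fun l hl => ?_
    rw [← Matrix.spectrum_toLin', ← Module.End.hasEigenvalue_iff_mem_spectrum] at hl
    obtain ⟨z, hz⟩ := hl.exists_hasEigenvector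
    have hz1 := hz.apply_eq_smul
    have hz0 := hz.2
    rw [Matrix.toLin'_apply] at hz1
    -- By the triangle inequality, the moduli of a complex eigenvector are subinvariant for `‖l‖`;
    -- pairing with `x` then bounds `‖l‖` by `r`.
    have hsub : ∀ i, ‖l‖ * ‖z i‖ ≤ (A *ᵥ fun j => ‖z j‖) i := by
      intro i
      rw [← norm_mul, ← smul_eq_mul, ← Pi.smul_apply, ← hz1]
      refine (norm_sum_le _ _).trans (Finset.sum_le_sum fun j _ => ?_)
      simp [abs_of_nonneg (h0 i j)]
    have h1 : x ⬝ᵥ (A *ᵥ fun j => ‖z j‖) = r * (x ⬝ᵥ fun j => ‖z j‖) := by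
      rw [Matrix.dotProduct_mulVec, ← Matrix.mulVec_transpose, hA.eq, h, smul_dotProduct,
        smul_eq_mul]
    have h2 : ‖l‖ * (x ⬝ᵥ fun j => ‖z j‖) ≤ x ⬝ᵥ (A *ᵥ fun j => ‖z j‖) := by
      rw [dotProduct, dotProduct, Finset.mul_sum]
      refine Finset.sum_le_sum (fun i _ => ?_)
      nlinarith [mul_le_mul_of_nonneg_left (hsub i) (hx i).le]
    have h3 : 0 < x ⬝ᵥ fun j => ‖z j‖ := by
      obtain ⟨i, hi⟩ := Function.ne_iff.1 hz0
      exact Finset.sum_pos' (fun i _ => mul_nonneg (hx i).le (norm_nonneg _))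
        ⟨i, Finset.mem_univ _, mul_pos (hx i) (norm_pos_iff.2 hi)⟩
    rw [h1] at h2
    have h4 := le_of_mul_le_mul_right h2 h3
    exact (ofReal_norm (E := ℂ) l).symm.trans_le (ENNReal.ofReal_le_ofReal h4)
  · have hmem : (r : ℂ) ∈ spectrum ℂ (A.map ((↑) : ℝ → ℂ)) := by
      rw [← Matrix.spectrum_toLin', ← Module.End.hasEigenvalue_iff_mem_spectrum]
      refine Module.End.hasEigenvalue_of_hasEigenvector (x := fun i => (x i : ℂ)) ?_
      rw [Module.End.hasEigenvector_iff, Module.End.mem_eigenspace_iff, Matrix.toLin'_apply]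
      refine ⟨?_, ?_⟩
      · funext i
        have := congrArg ((↑) : ℝ → ℂ) (congrFun h i)
        simpa [Matrix.mulVec, dotProduct] using this
      · obtain ⟨i⟩ := ‹Nonempty V›
        exact fun h => (hx i).ne' (by simpa using congrFun h i)
    refine le_trans (le_of_eq ?_) (le_iSup₂ (f := fun l _ => ENNReal.ofNNReal ‖l‖₊) (r : ℂ) hmem)
    rw [ENNReal.ofReal]
    congr 1
    ext
    rw [coe_nnnorm, Complex.norm_real, Real.norm_of_nonneg hr, Real.coe_toNNReal _ hr]

end PerronFrobenius

/-! ### Adjacency matrices of uniform edge families -/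

section EdgeWeightMatrix

open Matrix

/-- The real adjacency matrix of a `k`-uniform family of edges `F`. -/
noncomputable def edgeWeightMatrix {V E : Type*} [Fintype E] (F : E → Set V) (k : ℕ) :
    Matrix V V ℝ :=
  open Classical in
  Matrix.of fun i j =>
    if i = j then 0 else ∑ e, if i ∈ F e ∧ j ∈ F e then 1 / ((k : ℝ) - 1) else 0

variable {V E : Type*} [Fintype E] {F : E → Set V} {k : ℕ}

theorem edgeWeightMatrix_isSymm : (edgeWeightMatrix F k).IsSymm := by
  classical
  ext i j
  by_cases hij : i = j
  · rw [hij, Matrix.transpose_apply]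
  · simp only [edgeWeightMatrix, Matrix.transpose_apply, Matrix.of_apply, if_neg hij,
      if_neg (Ne.symm hij)]
    exact Finset.sum_congr rfl fun e _ => if_congr and_comm rfl rfl

theorem edgeWeightMatrix_nonneg (hk : 3 ≤ k) (i j : V) : 0 ≤ edgeWeightMatrix F k i j := by
  have : (0 : ℝ) < (k : ℝ) - 1 := by
    have : (3 : ℝ) ≤ k := by exact_mod_cast hk
    linarith
  simp only [edgeWeightMatrix, Matrix.of_apply]
  split_ifs
  · exact le_rfl
  · exact Finset.sum_nonneg fun e _ => by split_ifs <;> positivity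

theorem edgeWeightMatrix_pos (hk : 3 ≤ k) {i j : V} (hij : i ≠ j) {e : E} (hi : i ∈ F e)
    (hj : j ∈ F e) : 0 < edgeWeightMatrix F k i j := by
  have : (0 : ℝ) < (k : ℝ) - 1 := by
    have : (3 : ℝ) ≤ k := by exact_mod_cast hk
    linarith
  simp only [edgeWeightMatrix, Matrix.of_apply, if_neg hij]
  refine Finset.sum_pos' (fun e _ => by split_ifs <;> positivity) ⟨e, Finset.mem_univ _, ?_⟩
  rw [if_pos ⟨hi, hj⟩]
  positivity

-- Each edge through `i` contributes its total minus the value at `i`, so eigenvalue equations can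
-- be written in terms of edge sums.
open Classical in
theorem edgeWeightMatrix_mulVec [Fintype V] (hk : 3 ≤ k) (x : V → ℝ) (i : V) :
    ((k : ℝ) - 1) * (edgeWeightMatrix F k *ᵥ x) i =
      ∑ e, if i ∈ F e then (∑ v with v ∈ F e, x v) - x i else 0 := by
  have hk' : (k : ℝ) - 1 ≠ 0 := by
    have : (3 : ℝ) ≤ k := by exact_mod_cast hk
    linarith
  have h : ∀ j, ((k : ℝ) - 1) * (edgeWeightMatrix F k i j * x j) =
      ∑ e, if i ∈ F e then (if j ∈ F e then if j = i then 0 else x j else 0) else 0 := by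
    intro j
    rw [edgeWeightMatrix, Matrix.of_apply]
    by_cases hij : i = j
    · simp [hij]
    · rw [if_neg hij, Finset.sum_mul, Finset.mul_sum]
      refine Finset.sum_congr rfl fun e _ => ?_
      by_cases hi : i ∈ F e <;> by_cases hj : j ∈ F e <;> simp [hi, hj, Ne.symm hij, hk']
  rw [Matrix.mulVec, dotProduct, Finset.mul_sum, Finset.sum_congr rfl fun j _ => h j,
    Finset.sum_comm]
  refine Finset.sum_congr rfl fun e _ => ?_
  split_ifs with hi
  · rw [← Finset.sum_filter, eq_sub_iff_add_eq,
      ← Finset.add_sum_erase _ x (Finset.mem_filter.2 ⟨Finset.mem_univ i, hi⟩),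
      ← Finset.add_sum_erase _ (fun j => if j = i then 0 else x j)
        (Finset.mem_filter.2 ⟨Finset.mem_univ i, hi⟩), if_pos rfl, zero_add, add_comm]
    congr 1
    exact Finset.sum_congr rfl fun j hj => if_neg (Finset.ne_of_mem_erase hj)
  · simp

/-- The spectral radius of a uniform hypergraph that uses all vertices. -/
theorem Hypergraph.rho_eq_spectralRadius [Fintype V] [DecidableEq V] (H : Hypergraph V)
    [Finite H.vertexSet]
    (hV : ∀ v, v ∈ H.vertexSet) (hE : H.edgeSet = Set.range F) (hF : Function.Injective F)
    (hcard : ∀ e, (F e).ncard = k) :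
    H.rho = spectralRadius ℂ ((edgeWeightMatrix F k).map ((↑) : ℝ → ℂ)) := by
  classical
  let : Fintype H.vertexSet := Fintype.ofFinite _
  let e : V ≃ H.vertexSet := (Equiv.subtypeUnivEquiv hV).symm
  have hM : H.adjacencyMatrix =
      Matrix.reindexAlgEquiv ℂ ℂ e ((edgeWeightMatrix F k).map ((↑) : ℝ → ℂ)) := by
    ext ⟨i, hi⟩ ⟨j, hj⟩
    simp only [adjacencyMatrix, edgeWeightMatrix, Matrix.of_apply, Matrix.coe_reindexAlgEquiv,
      Matrix.reindex_apply, Matrix.submatrix_apply, Matrix.map_apply, e, Equiv.symm_symm,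
      Equiv.subtypeUnivEquiv_apply, Subtype.mk.injEq]
    split_ifs with hij
    · simp
    · have hset : {s : Set V | s ∈ H.edgeSet ∧ i ∈ s ∧ j ∈ s} = F '' {a | i ∈ F a ∧ j ∈ F a} := by
        ext s
        rw [hE]
        constructor
        · rintro ⟨⟨a, rfl⟩, h⟩
          exact ⟨a, h, rfl⟩
        · rintro ⟨a, h, rfl⟩
          exact ⟨⟨a, rfl⟩, h⟩
      rw [hset, finsum_mem_image hF.injOn, finsum_mem_def, finsum_eq_sum_of_fintype,
        Complex.ofReal_sum]
      refine Finset.sum_congr rfl fun a _ => ?_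
      rw [Set.indicator_apply, hcard]
      by_cases h : i ∈ F a ∧ j ∈ F a <;> simp [h]
  have hs : spectrum ℂ H.adjacencyMatrix =
      spectrum ℂ ((edgeWeightMatrix F k).map ((↑) : ℝ → ℂ)) := by
    rw [hM, AlgEquiv.spectrum_eq]
  rw [rho, spectralRadius, spectralRadius, ← hs]
  congr!

end EdgeWeightMatrix

/-! ### Edges, edge sums and connectedness of lollipops -/

namespace Hypergraph

/-- The edges of a hypercycle with a pendant hyperpath attached at the vertex `w`. -/
def lollipopEdge (n k s : ℕ) (w : CycleVertex n k) :
    Fin n ⊕ Fin s → Set (AttachVertex (CycleVertex n k) k s) :=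
  Sum.elim (fun i => Sum.inl '' cycleEdge n k i) (pathEdge w k)

theorem cyclicSucc_eq_finRotate {n : ℕ} (i : Fin n) : cyclicSucc i = finRotate n i := by
  cases n with
  | zero => exact i.elim0
  | succ n =>
    rw [finRotate_apply]
    ext
    rw [Fin.val_add, cyclicSucc, Fin.val_one', Nat.add_mod_mod]

theorem finRotate_ne_self {n : ℕ} (hn : 2 ≤ n) (i : Fin n) : finRotate n i ≠ i := by
  rw [← cyclicSucc_eq_finRotate]
  intro h
  have h1 : (i.val + 1) % n = i.val := congrArg Fin.val h
  have h2 := i.isLt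
  rcases Nat.lt_or_ge (i.val + 1) n with h3 | h3
  · rw [Nat.mod_eq_of_lt h3] at h1
    omega
  · have : i.val + 1 = n := by omega
    rw [this, Nat.mod_self] at h1
    omega

section Sums

open Classical in
theorem sum_filter_pair_union_range {V ι M : Type*} [Fintype V] [Fintype ι] [AddCommMonoid M]
    {S : Set V} {a b : V} {c : ι → V} (hS : S = {a, b} ∪ Set.range c) (hab : a ≠ b) (ha : ∀ j, c j ≠ a) (hb : ∀ j, c j ≠ b)
    (hc : Function.Injective c) (x : V → M) :
    ∑ v with v ∈ S, x v = x a + x b + ∑ j, x (c j) := by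
  have : ({v | v ∈ S} : Finset V) = {a, b} ∪ Finset.univ.image c := by
    ext v; simp [hS, or_assoc]
  rw [this, Finset.sum_union, Finset.sum_pair hab, Finset.sum_image fun i _ j _ h => hc h]
  rw [Finset.disjoint_left]
  rintro v hv hv'
  obtain ⟨j, -, rfl⟩ := Finset.mem_image.1 hv'
  simp [ha, hb] at hv

variable {n k s : ℕ}

/-- The sum of a vector over an edge of a hypercycle. -/
def cycleSum (f : CycleVertex n k → ℝ) (i : Fin n) : ℝ :=
  f (Sum.inl i) + f (Sum.inl (finRotate n i)) + ∑ j, f (Sum.inr (i, j))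

/-- The sum of a vector over an edge of a pendant hyperpath, where `z` is the value at the vertex of
attachment. -/
def pathSum (z : ℝ) (q : Fin s ⊕ Fin s × Fin (k - 2) → ℝ) (t : Fin s) : ℝ :=
  (if t.val = 0 then z else q (Sum.inl ⟨t.val - 1, lt_of_le_of_lt (Nat.sub_le _ _) t.isLt⟩)) +
    q (Sum.inl t) + ∑ j, q (Sum.inr (t, j))

theorem lollipopEdge_inl (w : CycleVertex n k) (i : Fin n) :
    lollipopEdge n k s w (Sum.inl i) = {Sum.inl (Sum.inl i), Sum.inl (Sum.inl (finRotate n i))} ∪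
      Set.range fun j : Fin (k - 2) => Sum.inl (Sum.inr (i, j)) := by
  simp only [lollipopEdge, Sum.elim_inl, cycleEdge, Set.image_union, Set.image_pair,
    cyclicSucc_eq_finRotate, ← Set.range_comp]
  rfl

open Classical in
theorem sum_lollipopEdge_inl (hn : 2 ≤ n) (w : CycleVertex n k) (i : Fin n)
    (x : AttachVertex (CycleVertex n k) k s → ℝ) :
    ∑ v with v ∈ lollipopEdge n k s w (Sum.inl i), x v = cycleSum (fun v => x (Sum.inl v)) i := by
  rw [sum_filter_pair_union_range (lollipopEdge_inl w i) _ _ _ _, cycleSum]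
  · simpa using (finRotate_ne_self hn i).symm
  · simp
  · simp
  · intro j j'; simp

open Classical in
theorem sum_lollipopEdge_inr (w : CycleVertex n k) (t : Fin s)
    (x : AttachVertex (CycleVertex n k) k s → ℝ) :
    ∑ v with v ∈ lollipopEdge n k s w (Sum.inr t), x v =
      pathSum (x (Sum.inl w)) (fun v => x (Sum.inr v)) t := by
  have h : lollipopEdge n k s w (Sum.inr t) = {pathStart w k t, Sum.inr (Sum.inl t)} ∪
      Set.range fun j : Fin (k - 2) => Sum.inr (Sum.inr (t, j)) := rfl
  rw [sum_filter_pair_union_range h _ _ _ _, pathSum]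
  · congr 2
    unfold pathStart
    split_ifs <;> rfl
  · unfold pathStart
    split_ifs with h
    · simp
    · simp only [ne_eq, Sum.inr.injEq, Sum.inl.injEq, Fin.ext_iff]
      omega
  · unfold pathStart
    intro j
    split_ifs <;> simp
  · simp
  · intro j j'; simp

open Classical in
theorem ncard_lollipopEdge (hn : 2 ≤ n) (hk : 3 ≤ k) (w : CycleVertex n k) (e : Fin n ⊕ Fin s) :
    (lollipopEdge n k s w e).ncard = k := by
  -- The cardinality is the edge sum of the constant vector `1`.
  have h : ∑ v with v ∈ lollipopEdge n k s w e, (1 : ℝ) = k := by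
    have hk' : (((k - 2 : ℕ) : ℝ)) = k - 2 := by
      rw [Nat.cast_sub (by omega)]; norm_num
    rcases e with i | t
    · rw [sum_lollipopEdge_inl hn w i fun _ => 1, cycleSum]
      simp [hk']; ring
    · rw [sum_lollipopEdge_inr w t fun _ => 1, pathSum]
      simp [hk']; ring
  rw [Finset.sum_const, nsmul_one] at h
  rw [Set.ncard_eq_toFinset_card', ← Nat.cast_inj (R := ℝ), ← h, Set.filter_mem_univ_eq_toFinset]

theorem lollipopEdge_injective (hk : 3 ≤ k) (w : CycleVertex n k) :
    Function.Injective (lollipopEdge n k s w) := by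
  rintro (i | t) (i' | t') h
  · have : (Sum.inl (Sum.inr (i, ⟨0, by omega⟩)) : AttachVertex (CycleVertex n k) k s) ∈
        lollipopEdge n k s w (Sum.inl i') := by
      rw [← h]; simp [lollipopEdge_inl]
    simp [lollipopEdge_inl] at this
    rw [this]
  · have : (Sum.inr (Sum.inl t') : AttachVertex (CycleVertex n k) k s) ∈
        lollipopEdge n k s w (Sum.inl i) := by
      rw [h]; simp [lollipopEdge, pathEdge]
    simp [lollipopEdge_inl] at this
  · have : (Sum.inr (Sum.inl t) : AttachVertex (CycleVertex n k) k s) ∈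
        lollipopEdge n k s w (Sum.inl i') := by
      rw [← h]; simp [lollipopEdge, pathEdge]
    simp [lollipopEdge_inl] at this
  · have : (Sum.inr (Sum.inr (t, ⟨0, by omega⟩)) : AttachVertex (CycleVertex n k) k s) ∈
        lollipopEdge n k s w (Sum.inr t') := by
      rw [← h]; simp [lollipopEdge, pathEdge]
    simp only [lollipopEdge, pathEdge, pathStart, Sum.elim_inr] at this
    split_ifs at this <;> simp at this <;> rw [this]

end Sums

variable {n k s : ℕ}

/-- The spectral radius of a hypercycle with an attached hyperpath in terms of the real adjacency
matrix. -/
theorem rho_attachHyperpath (hn : 2 ≤ n) (hk : 3 ≤ k) (w : CycleVertex n k)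
    [Finite ((hypercycle n k).attachHyperpath w (mem_vertexSet_hypercycle n k w) k s).vertexSet] :
    ((hypercycle n k).attachHyperpath w (mem_vertexSet_hypercycle n k w) k s).rho =
      spectralRadius ℂ ((edgeWeightMatrix (lollipopEdge n k s w) k).map ((↑) : ℝ → ℂ)) := by
  refine rho_eq_spectralRadius _ ?_ ?_ (lollipopEdge_injective hk w) (ncard_lollipopEdge hn hk w)
  · rintro (v | v)
    · exact Or.inl ⟨v, mem_vertexSet_hypercycle n k v, rfl⟩
    · exact Or.inr ⟨v, rfl⟩
  · rw [lollipopEdge, Set.Sum.elim_range]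
    exact congrArg (· ∪ _) (Set.range_comp _ _).symm

/-- Irreducibility: vertices sharing an edge are related, so every vertex is reached from junction
`0` along the cycle and then the path; symmetry does the rest. -/
theorem reflTransGen_edgeWeightMatrix (hk : 3 ≤ k) (w : CycleVertex n k)
    (u v : AttachVertex (CycleVertex n k) k s) :
    Relation.ReflTransGen (fun i j => 0 < edgeWeightMatrix (lollipopEdge n k s w) k i j) u v := by
  set R := Relation.ReflTransGen
    (fun i j => 0 < edgeWeightMatrix (lollipopEdge n k s w) k i j) with hR
  have : Std.Symm fun i j => 0 < edgeWeightMatrix (lollipopEdge n k s w) k i j :=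
    ⟨fun i j h => by rwa [edgeWeightMatrix_isSymm.apply]⟩
  have hsymm : ∀ u v, R u v → R v u := fun u v h => Std.Symm.symm _ _ h
  have hedge : ∀ e u v, u ∈ lollipopEdge n k s w e → v ∈ lollipopEdge n k s w e → R u v := by
    intro e u v hu hv
    by_cases h : u = v
    · rw [h]
    · exact .single (edgeWeightMatrix_pos hk h hu hv)
  have hn : 0 < n := by rcases w with i | i <;> [exact i.pos; exact i.1.pos]
  let o : AttachVertex (CycleVertex n k) k s := Sum.inl (Sum.inl ⟨0, hn⟩)
  have hjunction : ∀ i (hi : i < n), R o (Sum.inl (Sum.inl ⟨i, hi⟩)) := by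
    intro i
    induction i with
    | zero => intro _; exact .refl
    | succ i ih =>
      intro hi
      refine (ih (by omega)).trans (hedge (Sum.inl ⟨i, by omega⟩) _ _ ?_ ?_)
      · simp [lollipopEdge_inl]
      · rw [lollipopEdge_inl, ← cyclicSucc_eq_finRotate]
        simp [cyclicSucc, Nat.mod_eq_of_lt hi]
  have hcycle : ∀ v, R o (Sum.inl v) := by
    rintro (i | ⟨i, j⟩)
    · exact hjunction i.1 i.2
    · refine (hjunction i.1 i.2).trans (hedge (Sum.inl i) _ _ ?_ ?_) <;> simp [lollipopEdge_inl]
  have hpath : ∀ t (ht : t < s), R o (Sum.inr (Sum.inl ⟨t, ht⟩)) := by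
    intro t
    induction t with
    | zero =>
      intro ht
      refine (hcycle w).trans (hedge (Sum.inr ⟨0, ht⟩) _ _ ?_ ?_) <;>
        simp [lollipopEdge, pathEdge, pathStart]
    | succ t ih =>
      intro ht
      refine (ih (by omega)).trans (hedge (Sum.inr ⟨t + 1, ht⟩) _ _ ?_ ?_) <;>
        simp [lollipopEdge, pathEdge, pathStart]
  have hall : ∀ v, R o v := by
    rintro (v | t | ⟨t, j⟩)
    · exact hcycle v
    · exact hpath t.1 t.2
    · refine (hpath t.1 t.2).trans (hedge (Sum.inr t) _ _ ?_ ?_) <;>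
        simp [lollipopEdge, pathEdge]
  exact (hsymm _ _ (hall u)).trans (hall v)

/-! ### Eigenvalue equations at path, junction and interior vertices -/

section Rows

open Matrix

open Classical in
/-- The rows of the adjacency operator at the vertices of a pendant hyperpath, scaled by `k - 1`, as
a function of the value `z` at the vertex of attachment. -/
noncomputable def pathRow (z : ℝ) (q : Fin s ⊕ Fin s × Fin (k - 2) → ℝ)
    (v : Fin s ⊕ Fin s × Fin (k - 2)) : ℝ :=
  ∑ t, if (Sum.inr v : AttachVertex Unit k s) ∈ pathEdge () k t then pathSum z q t - q v else 0

theorem pathSum_mono {z z' : ℝ} (h : z ≤ z') (q : Fin s ⊕ Fin s × Fin (k - 2) → ℝ) (t : Fin s) :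
    pathSum z q t ≤ pathSum z' q t := by
  unfold pathSum
  gcongr
  split_ifs
  · exact h
  · exact le_rfl

theorem pathRow_mono {z z' : ℝ} (h : z ≤ z') (q : Fin s ⊕ Fin s × Fin (k - 2) → ℝ)
    (v : Fin s ⊕ Fin s × Fin (k - 2)) : pathRow z q v ≤ pathRow z' q v := by
  unfold pathRow
  refine Finset.sum_le_sum fun t _ => ?_
  split_ifs
  · exact sub_le_sub_right (pathSum_mono h q t) _
  · exact le_rfl

/-- Incidence of the new vertices does not depend on the host, so `pathRow` serves cycles of both
lengths. -/
theorem inr_mem_pathEdge {α : Type*} (w : α) (v : Fin s ⊕ Fin s × Fin (k - 2)) (t : Fin s) :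
    (Sum.inr v : AttachVertex α k s) ∈ pathEdge w k t ↔
      (Sum.inr v : AttachVertex Unit k s) ∈ pathEdge () k t := by
  unfold pathEdge pathStart
  split_ifs <;> simp

theorem inl_mem_pathEdge {α : Type*} (w v : α) (t : Fin s) :
    (Sum.inl v : AttachVertex α k s) ∈ pathEdge w k t ↔ t.val = 0 ∧ v = w := by
  unfold pathEdge pathStart
  split_ifs with h <;> simp [h]

variable (x : AttachVertex (CycleVertex n k) k s → ℝ) (w : CycleVertex n k)

theorem mulVec_inr (hk : 3 ≤ k) (v : Fin s ⊕ Fin s × Fin (k - 2)) :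
    ((k : ℝ) - 1) * (edgeWeightMatrix (lollipopEdge n k s w) k *ᵥ x) (Sum.inr v) =
      pathRow (x (Sum.inl w)) (fun v => x (Sum.inr v)) v := by
  classical
  rw [edgeWeightMatrix_mulVec hk, Fintype.sum_sum_type, pathRow]
  simp only [sum_lollipopEdge_inr]
  rw [Finset.sum_eq_zero, zero_add]
  · refine Finset.sum_congr rfl fun t _ => ?_
    simp only [lollipopEdge, Sum.elim_inr, inr_mem_pathEdge w]
  · intro i _
    simp [lollipopEdge_inl]

/-- Only the first path edge meets the cycle; removing the attaching vertex's own value amounts to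
setting `z = 0` in `pathSum`. -/
theorem sum_pathEdge_inl (hs : 1 ≤ s) (v : CycleVertex n k) :
    (∑ t, open Classical in if (Sum.inl v : AttachVertex (CycleVertex n k) k s) ∈
        lollipopEdge n k s w (Sum.inr t) then
      pathSum (x (Sum.inl w)) (fun v => x (Sum.inr v)) t - x (Sum.inl v) else 0) =
    if v = w then pathSum 0 (fun v => x (Sum.inr v)) ⟨0, hs⟩ else 0 := by
  simp only [lollipopEdge, Sum.elim_inr, inl_mem_pathEdge]
  by_cases h : v = w
  · subst h
    rw [Finset.sum_eq_single ⟨0, hs⟩]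
    · simp only [and_self, if_true, pathSum]
      ring
    · intro t _ ht
      rw [if_neg fun h => ht (Fin.ext h.1)]
    · simp
  · simp [h]

theorem mulVec_junction (hn : 2 ≤ n) (hk : 3 ≤ k) (hs : 1 ≤ s) (i : Fin n) :
    ((k : ℝ) - 1) * (edgeWeightMatrix (lollipopEdge n k s w) k *ᵥ x) (Sum.inl (Sum.inl i)) =
      cycleSum (fun v => x (Sum.inl v)) i +
        cycleSum (fun v => x (Sum.inl v)) ((finRotate n).symm i) - 2 * x (Sum.inl (Sum.inl i)) +
        if Sum.inl i = w then pathSum 0 (fun v => x (Sum.inr v)) ⟨0, hs⟩ else 0 := by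
  classical
  rw [edgeWeightMatrix_mulVec hk, Fintype.sum_sum_type]
  simp only [sum_lollipopEdge_inr, sum_lollipopEdge_inl hn]
  rw [sum_pathEdge_inl x w hs]
  congr 1
  have hne : i ≠ (finRotate n).symm i := by
    intro h
    exact finRotate_ne_self hn i ((Equiv.eq_symm_apply _).1 h)
  rw [← Finset.sum_subset (Finset.subset_univ {i, (finRotate n).symm i}), Finset.sum_pair hne]
  · simp only [lollipopEdge_inl, Equiv.apply_symm_apply]
    simp
    ring
  · intro e _ he
    simp only [Finset.mem_insert, Finset.mem_singleton, not_or, Equiv.eq_symm_apply] at he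
    rw [if_neg]
    simp [lollipopEdge_inl, Ne.symm he.1, Ne.symm he.2, -finRotate_apply]

theorem mulVec_interior (hn : 2 ≤ n) (hk : 3 ≤ k) (hs : 1 ≤ s) (i : Fin n) (j : Fin (k - 2)) :
    ((k : ℝ) - 1) * (edgeWeightMatrix (lollipopEdge n k s w) k *ᵥ x) (Sum.inl (Sum.inr (i, j))) =
      cycleSum (fun v => x (Sum.inl v)) i - x (Sum.inl (Sum.inr (i, j))) +
        if Sum.inr (i, j) = w then pathSum 0 (fun v => x (Sum.inr v)) ⟨0, hs⟩ else 0 := by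
  classical
  rw [edgeWeightMatrix_mulVec hk, Fintype.sum_sum_type]
  simp only [sum_lollipopEdge_inr, sum_lollipopEdge_inl hn]
  rw [sum_pathEdge_inl x w hs]
  congr 1
  rw [Finset.sum_eq_single i]
  · simp [lollipopEdge_inl]
  · intro e _ he
    simp [lollipopEdge_inl, he]
  · simp

end Rows

end Hypergraph

/-! ### The reduced cyclic system and deletion of a minimum -/

section CyclicSystem

variable {ι : Type*} [DecidableEq ι] {σ : Equiv.Perm ι} {X S : ι → ℝ} {o : ι}
  {r β d e : ℝ}

/-- In a cyclic system with a nonnegative nonzero source at one place, the product of the two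
coefficients exceeds its value for a constant solution without source. -/
theorem four_lt_of_cyclic_source [Fintype ι] (hX : ∀ i, 0 < X i) (hβ : 0 < β) (hd : 0 ≤ d) (he : 0 ≤ e)
    (hde : 0 < d + e)
    (hr : ∀ i, (r + 2) * X i = S i + S (σ.symm i) + if i = o then e else 0)
    (hS : ∀ i, β * S i = X i + X (σ i) + if i = o then d else 0) : 4 < β * (r + 2) := by
  have h1 : (r + 2) * ∑ i, X i = 2 * ∑ i, S i + e := by
    rw [Finset.mul_sum, Finset.sum_congr rfl fun i _ => hr i, Finset.sum_add_distrib,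
      Finset.sum_add_distrib, Equiv.sum_comp σ.symm S]
    simp
    ring
  have h2 : β * ∑ i, S i = 2 * ∑ i, X i + d := by
    rw [Finset.mul_sum, Finset.sum_congr rfl fun i _ => hS i, Finset.sum_add_distrib,
      Finset.sum_add_distrib, Equiv.sum_comp σ X]
    simp
    ring
  have h3 : 0 < ∑ i, X i := Finset.sum_pos (fun i _ => hX i) ⟨o, Finset.mem_univ o⟩
  have h4 : (β * (r + 2)) * ∑ i, X i = 4 * ∑ i, X i + (2 * d + β * e) := by
    linear_combination β * h1 + 2 * h2
  have h5 : 0 < 2 * d + β * e := by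
    rcases hd.eq_or_lt with h | h
    · have : 0 < e := by linarith
      rw [← h]; positivity
    · positivity
  by_contra! h
  nlinarith

/-- The minimum of a positive solution of a cyclic system is attained away from the source. -/
theorem exists_ne_forall_le_of_cyclic_source [Finite ι] (hσ : σ o ≠ o) (hX : ∀ i, 0 < X i) (hβ : 0 < β)
    (he : 0 ≤ e) (h4 : 4 < β * (r + 2))
    (hr : ∀ i, (r + 2) * X i = S i + S (σ.symm i) + if i = o then e else 0)
    (hS : ∀ i, β * S i = X i + X (σ i) + if i = o then d else 0) :
    ∃ m, m ≠ o ∧ ∀ i, X m ≤ X i := by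
  -- Eliminating `S` leaves a second-order recurrence in `X`, with sources only at `o` and `σ o`.
  have hX2 : ∀ i, β * (r + 2) * X i = 2 * X i + X (σ i) + X (σ.symm i) + (if i = o then d else 0) +
      (if σ.symm i = o then d else 0) + β * if i = o then e else 0 := by
    intro i
    have h := hS (σ.symm i)
    rw [Equiv.apply_symm_apply] at h
    linear_combination β * hr i + hS i + h
  have : Nonempty ι := ⟨o⟩
  obtain ⟨m, hm⟩ := Finite.exists_min X
  by_contra! hcon
  have hlt : ∀ i, i ≠ o → X o < X i := by
    have hmo : m = o := by
      by_contra h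
      obtain ⟨i, hi⟩ := hcon m h
      exact absurd (hm i) hi.not_ge
    intro i hi
    obtain ⟨j, hj⟩ := hcon i hi
    exact (hmo ▸ hm j).trans_lt hj
  obtain ⟨M, hM⟩ := Finite.exists_max X
  have hMo : M ≠ o := by
    rintro rfl
    exact absurd (hM (σ M)) (hlt _ hσ).not_ge
  -- A maximum at a source-free place would give `β (r + 2) ≤ 4`.
  have hMs : σ.symm M = o := by
    by_contra h
    have h1 := hX2 M
    rw [if_neg hMo, if_neg h, if_neg hMo] at h1
    nlinarith [hM (σ M), hM (σ.symm M), hX M]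
  have hos : σ.symm o ≠ o := fun h => hσ ((Equiv.symm_apply_eq _).1 h).symm
  have h1 := hX2 M
  have h2 := hX2 o
  have hMe : σ o = M := ((Equiv.symm_apply_eq _).1 hMs).symm
  rw [if_neg hMo, if_pos hMs, if_neg hMo, hMs] at h1
  rw [if_pos rfl, if_neg hos, if_pos rfl, hMe] at h2
  have h3 := hlt M hMo
  have h5 := hM (σ M)
  have h6 := hlt _ hos
  -- Subtracting the recurrences at `M = σ o` and `o` cancels the two sources `d`.
  have h7 : β * (r + 2) * (X M - X o) ≤ 2 * (X M - X o) := by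
    nlinarith [mul_nonneg hβ.le he]
  nlinarith

/-- Comparison of the edge sums of a cyclic system with those of the system in which a place `m` of
minimal value is removed. -/
theorem le_of_delete_min {κ : Type*} {τ : Equiv.Perm κ} {φ : κ → ι} {c : κ} {m : ι} {S' : κ → ℝ}
    (hβ : 0 < β) (hd : 0 ≤ d) (hmo : m ≠ o) (hmin : ∀ i, X m ≤ X i)
    (hS : ∀ i, β * S i = X i + X (σ i) + if i = o then d else 0)
    (hφ : ∀ i, i ≠ c → φ (τ i) = σ (φ i)) (hc : σ (φ c) = m) (hc' : φ (τ c) = σ m)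
    (hS' : ∀ i, β * S' i = X (φ i) + X (φ (τ i)) + if φ i = o then d else 0) :
    (∀ i, S (φ i) ≤ S' i) ∧ ∀ i, S (σ.symm (φ (τ i))) ≤ S' i := by
  have hd' : ∀ i, 0 ≤ if φ i = o then d else 0 := fun i => by split_ifs <;> [exact hd; exact le_rfl]
  have h1 : S (φ c) ≤ S' c := by
    have h := hS (φ c)
    rw [hc] at h
    have h' := hS' c
    rw [hc'] at h'
    nlinarith [hmin (σ m)]
  -- Merging replaces `X m` by `X (φ c)`, and edge `m` carries no source since `m ≠ o`.
  have h2 : S m ≤ S' c := by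
    have h := hS m
    rw [if_neg hmo] at h
    have h' := hS' c
    rw [hc'] at h'
    nlinarith [hmin (φ c), hd' c]
  have h3 : ∀ i, i ≠ c → S (φ i) = S' i := by
    intro i hi
    refine mul_left_cancel₀ hβ.ne' ?_
    rw [hS, hS', hφ i hi]
  constructor
  · intro i
    by_cases hi : i = c
    · rw [hi]; exact h1
    · exact (h3 i hi).le
  · intro i
    by_cases hi : i = c
    · rw [hi, hc', Equiv.symm_apply_apply]; exact h2
    · rw [hφ i hi, Equiv.symm_apply_apply]; exact (h3 i hi).le

/-- In the situation of `le_of_delete_min`, one of the two edge sums at `m` is strictly below the sum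
of the merged edge. -/
theorem lt_of_delete_min {κ : Type*} {τ : Equiv.Perm κ} {φ : κ → ι} {c : κ} {m : ι} {S' : κ → ℝ}
    (hX : ∀ i, 0 < X i) (hd : 0 ≤ d) (hmo : m ≠ o)
    (hmin : ∀ i, X m ≤ X i) (h4 : 4 < β * (r + 2))
    (hr : ∀ i, (r + 2) * X i = S i + S (σ.symm i) + if i = o then e else 0)
    (hS : ∀ i, β * S i = X i + X (σ i) + if i = o then d else 0)
    (hβ : 0 < β) (hc : σ (φ c) = m) (hc' : φ (τ c) = σ m)
    (hS' : ∀ i, β * S' i = X (φ i) + X (φ (τ i)) + if φ i = o then d else 0) :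
    S (φ c) < S' c ∨ S m < S' c := by
  -- Otherwise `X (σ m)` and `X (φ c)` plus any source there are at most `X m`, and the recurrence
  -- at `m` gives `β (r + 2) ≤ 4`.
  by_contra! hcon
  obtain ⟨h1, h2⟩ := hcon
  have hd' : 0 ≤ if φ c = o then d else 0 := by split_ifs <;> [exact hd; exact le_rfl]
  have e1 := hS (φ c)
  have e2 := hS m
  have e3 := hS' c
  have e4 := hr m
  rw [hc] at e1
  rw [if_neg hmo] at e2 e4
  rw [hc'] at e3
  rw [← hc, Equiv.symm_apply_apply, hc] at e4
  have h1' := mul_le_mul_of_nonneg_left h1 hβ.le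
  have h2' := mul_le_mul_of_nonneg_left h2 hβ.le
  have h5 : β * (r + 2) * X m = β * S m + β * S (φ c) := by linear_combination β * e4
  have := hmin (φ c)
  have := hmin (σ m)
  nlinarith [hX m]

end CyclicSystem

/-- Skipping a place `m ≠ 0` of a cycle. -/
theorem finRotate_succAbove {g : ℕ} (m : Fin (g + 1)) (hm : m.val ≠ 0) (hg : 2 ≤ g) :
    ∃ c : Fin g, (∀ i, i ≠ c → m.succAbove (finRotate g i) = finRotate (g + 1) (m.succAbove i)) ∧
      finRotate (g + 1) (m.succAbove c) = m ∧ m.succAbove (finRotate g c) = finRotate (g + 1) m := by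
  have hrot : ∀ {n} (i : Fin n),
      (finRotate n i).val = if i.val + 1 = n then 0 else i.val + 1 := by
    intro n i
    have := i.isLt
    rw [← Hypergraph.cyclicSucc_eq_finRotate, Hypergraph.cyclicSucc]
    split_ifs with h
    · simp [h]
    · exact Nat.mod_eq_of_lt (by omega)
  have habove : ∀ i : Fin g, (m.succAbove i).val = if i.val < m.val then i.val else i.val + 1 := by
    intro i
    simp only [Fin.succAbove, Fin.lt_def, Fin.val_castSucc]
    split_ifs <;> simp
  have hm' := m.isLt
  refine ⟨⟨m.val - 1, by omega⟩, fun i hi => ?_, ?_, ?_⟩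
  · have hi' : i.val ≠ m.val - 1 := fun h => hi (Fin.ext h)
    have := i.isLt
    rw [Fin.ext_iff, habove, hrot, hrot, habove]
    split_ifs <;> omega
  · rw [Fin.ext_iff, hrot, habove]
    dsimp only
    split_ifs <;> omega
  · rw [Fin.ext_iff, habove, hrot, hrot]
    dsimp only
    split_ifs <;> omega

/-! ### Comparison of the two lollipops -/

namespace Hypergraph

variable {n k s : ℕ}

/-- A vertex on the edge `o` of a hypercycle: the junction vertex with index `o`, or an interior
vertex. -/
def attachVertex (o : Fin n) (c : Option (Fin (k - 2))) : CycleVertex n k :=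
  c.elim (Sum.inl o) fun j => Sum.inr (o, j)

theorem ite_inl_eq_attachVertex (i o : Fin n) (c : Option (Fin (k - 2))) (P : ℝ) :
    (if Sum.inl i = attachVertex o c then P else 0) =
      if i = o then c.elim P fun _ => 0 else 0 := by
  cases c <;> simp [attachVertex]

theorem sum_ite_inr_eq_attachVertex (i o : Fin n) (c : Option (Fin (k - 2))) (P : ℝ) :
    (∑ j, if Sum.inr (i, j) = attachVertex o c then P else 0) =
      if i = o then c.elim 0 fun _ => P else 0 := by
  cases c with
  | none => simp [attachVertex]
  | some j =>
    by_cases h : i = o <;> simp [attachVertex, h]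

/-- Sums the `k - 2` interior equations. `T` is left free: it is the edge sum itself for the Perron
vector, but for the comparison vector it is a prescribed `S' i` not yet known to be the edge sum. -/
theorem cycleSum_of_interior (hk : 3 ≤ k) {f : CycleVertex n k → ℝ} {i o : Fin n}
    {c : Option (Fin (k - 2))} {r P T : ℝ} (hr : 0 < r + 1)
    (h : ∀ j, (r + 1) * f (Sum.inr (i, j)) =
      T + if Sum.inr (i, j) = attachVertex o c then P else 0) :
    cycleSum f i = f (Sum.inl i) + f (Sum.inl (finRotate n i)) + ((k : ℝ) - 2) / (r + 1) * T +
      if i = o then (c.elim 0 fun _ => P) / (r + 1) else 0 := by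
  have hk' : (((k - 2 : ℕ) : ℝ)) = k - 2 := by
    rw [Nat.cast_sub (by omega)]; norm_num
  have h1 : (r + 1) * ∑ j, f (Sum.inr (i, j)) =
      ((k : ℝ) - 2) * T + if i = o then c.elim 0 fun _ => P else 0 := by
    rw [Finset.mul_sum, Finset.sum_congr rfl fun j _ => h j, Finset.sum_add_distrib,
      sum_ite_inr_eq_attachVertex]
    simp [hk']
  have h2 : ∑ j, f (Sum.inr (i, j)) = ((k : ℝ) - 2) / (r + 1) * T +
      if i = o then (c.elim 0 fun _ => P) / (r + 1) else 0 := by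
    have : ∑ j, f (Sum.inr (i, j)) = (((k : ℝ) - 2) * T +
      if i = o then c.elim 0 fun _ => P else 0) / (r + 1) := by
      rw [← h1]; field_simp
    rw [this]
    split_ifs <;> ring
  rw [cycleSum, h2]
  ring

/-- Shortening the cycle of a lollipop increases the spectral radius: delete a junction vertex of
minimal value from the Perron vector of the longer lollipop, and compare. -/
theorem rho_attachHyperpath_lt {g : ℕ} (hg : 2 ≤ g) (hk : 3 ≤ k) (hs : 1 ≤ s)
    (c : Option (Fin (k - 2))) (o : Fin g) (o' : Fin (g + 1)) (ho : o.val = 0) (ho' : o'.val = 0) :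
    ((hypercycle (g + 1) k).attachHyperpath (attachVertex o' c)
        (mem_vertexSet_hypercycle _ k _) k s).rho <
      ((hypercycle g k).attachHyperpath (attachVertex o c)
        (mem_vertexSet_hypercycle _ k _) k s).rho := by
  have hg' : 2 ≤ g + 1 := by omega
  have hk1 : (0 : ℝ) < (k : ℝ) - 1 := by
    have : (3 : ℝ) ≤ k := by exact_mod_cast hk
    linarith
  have : Nonempty (AttachVertex (CycleVertex g k) k s) := ⟨Sum.inl (Sum.inl o)⟩
  have : Nonempty (AttachVertex (CycleVertex (g + 1) k) k s) := ⟨Sum.inl (Sum.inl o')⟩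
  obtain ⟨z, R, hz, hzR⟩ := edgeWeightMatrix_isSymm.exists_pos_eigenvector
    (edgeWeightMatrix_nonneg hk)
    (reflTransGen_edgeWeightMatrix (s := s) hk (attachVertex o c))
  obtain ⟨x, ρ, hx, hxρ⟩ := edgeWeightMatrix_isSymm.exists_pos_eigenvector
    (edgeWeightMatrix_nonneg hk)
    (reflTransGen_edgeWeightMatrix (s := s) hk (attachVertex o' c))
  rw [rho_attachHyperpath hg' hk, rho_attachHyperpath hg hk,
    edgeWeightMatrix_isSymm.spectralRadius_eq (edgeWeightMatrix_nonneg hk) hz hzR,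
    edgeWeightMatrix_isSymm.spectralRadius_eq (edgeWeightMatrix_nonneg hk) hx hxρ]
  let r : ℝ := ((k : ℝ) - 1) * ρ
  let f : CycleVertex (g + 1) k → ℝ := fun v => x (Sum.inl v)
  let q : Fin s ⊕ Fin s × Fin (k - 2) → ℝ := fun v => x (Sum.inr v)
  let P : ℝ := pathSum 0 q ⟨0, hs⟩
  let X : Fin (g + 1) → ℝ := fun i => f (Sum.inl i)
  let S : Fin (g + 1) → ℝ := cycleSum f
  have hmul : ∀ v, ((k : ℝ) - 1) *
      (edgeWeightMatrix (lollipopEdge (g + 1) k s (attachVertex o' c)) k).mulVec x v =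
        r * x v := by
    intro v; rw [hxρ, Pi.smul_apply, smul_eq_mul, mul_assoc]
  have hP : 0 < P := by
    have : ∀ v, 0 < q v := fun v => hx _
    have h1 : 0 ≤ ∑ j, q (Sum.inr (⟨0, hs⟩, j)) := Finset.sum_nonneg fun j _ => (this _).le
    simp only [P, pathSum, if_true]
    linarith [this (Sum.inl ⟨0, hs⟩)]
  have hX : ∀ i, 0 < X i := fun i => hx _
  have hSX : ∀ i, X i + X (finRotate _ i) ≤ S i := fun i =>
    le_add_of_nonneg_right (Finset.sum_nonneg fun j _ => (hx _).le)
  have hS0 : ∀ i, 0 < S i := fun i => by linarith [hSX i, hX i, hX (finRotate _ i)]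
  -- the eigenvalue equations on the cycle
  have hjun : ∀ i, (r + 2) * X i = S i + S ((finRotate (g + 1)).symm i) +
      if i = o' then c.elim P fun _ => 0 else 0 := by
    intro i
    have h := mulVec_junction x (attachVertex o' c) hg' hk hs i
    rw [hmul, ite_inl_eq_attachVertex] at h
    linear_combination h
  have hint : ∀ i j, (r + 1) * f (Sum.inr (i, j)) =
      S i + if Sum.inr (i, j) = attachVertex o' c then P else 0 := by
    intro i j
    have h := mulVec_interior x (attachVertex o' c) hg' hk hs i j
    rw [hmul] at h
    linear_combination h
  have hr1 : 0 < r + 1 := by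
    have h := hint o' ⟨0, by omega⟩
    have h' : 0 < (r + 1) * f (Sum.inr (o', ⟨0, by omega⟩)) := by
      rw [h]
      split_ifs <;> linarith [hS0 o']
    exact (pos_iff_pos_of_mul_pos h').2 (hx _)
  let β : ℝ := 1 - ((k : ℝ) - 2) / (r + 1)
  let d : ℝ := (c.elim 0 fun _ => P) / (r + 1)
  have hd : 0 ≤ d := by cases c <;> simp only [d, Option.elim] <;> positivity
  have he : 0 ≤ (c.elim P fun _ => 0) := by cases c <;> simp [hP.le]
  have hde : 0 < d + c.elim P fun _ => 0 := by
    cases c <;> simp only [d, Option.elim] <;> [simpa using hP; (rw [add_zero]; positivity)]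
  have hS : ∀ i, β * S i = X i + X (finRotate (g + 1) i) + if i = o' then d else 0 := by
    intro i
    have h := cycleSum_of_interior hk hr1 (hint i)
    simp only [β]
    linear_combination h
  have hβ : 0 < β := by
    have h : 0 < β * S o' := by
      rw [hS]
      have := hX o'
      have := hX (finRotate _ o')
      split_ifs <;> positivity
    exact (pos_iff_pos_of_mul_pos h).2 (hS0 o')
  have h4 := four_lt_of_cyclic_source hX hβ hd he hde hjun hS
  obtain ⟨m, hmo, hmin⟩ :=
    exists_ne_forall_le_of_cyclic_source (finRotate_ne_self hg' o') hX hβ he h4 hjun hS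
  have hm0 : m.val ≠ 0 := fun h => hmo (Fin.ext (h.trans ho'.symm))
  obtain ⟨a, ha, hac, hac'⟩ := finRotate_succAbove m hm0 hg
  have hao : ∀ i, m.succAbove i = o' ↔ i = o := by
    have : m.succAbove o = o' := by
      rw [Fin.ext_iff, Fin.succAbove, if_pos] <;>
        simp [Fin.lt_def, ho, ho', Nat.pos_of_ne_zero hm0]
    intro i
    rw [← this, Fin.succAbove_right_inj]
  -- the comparison vector
  let S' : Fin g → ℝ := fun i =>
    (X (m.succAbove i) + X (m.succAbove (finRotate g i)) + if m.succAbove i = o' then d else 0) / β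
  have hS' : ∀ i, β * S' i = X (m.succAbove i) + X (m.succAbove (finRotate g i)) +
      if m.succAbove i = o' then d else 0 := fun i => mul_div_cancel₀ _ hβ.ne'
  obtain ⟨hle, hle'⟩ := le_of_delete_min hβ hd hmo hmin hS ha hac hac' hS'
  have hlt := lt_of_delete_min hX hd hmo hmin h4 hjun hS hβ hac hac' hS'
  let f' : CycleVertex g k → ℝ := Sum.elim (fun i => X (m.succAbove i)) fun p =>
    (S' p.1 + if Sum.inr p = attachVertex o c then P else 0) / (r + 1)
  let y : AttachVertex (CycleVertex g k) k s → ℝ := Sum.elim f' q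
  have hint' : ∀ i j, (r + 1) * f' (Sum.inr (i, j)) =
      S' i + if Sum.inr (i, j) = attachVertex o c then P else 0 := fun i j =>
    mul_div_cancel₀ _ hr1.ne'
  have hsum : ∀ i, cycleSum f' i = S' i := by
    intro i
    have h := cycleSum_of_interior hk hr1 (hint' i)
    have h' := hS' i
    simp only [hao] at h'
    simp only [β] at h'
    change _ = X (m.succAbove i) + X (m.succAbove (finRotate g i)) + _ + _ at h
    rw [h]
    linear_combination -h'
  -- The value at the attaching vertex does not drop, so the rows on the unchanged path can only
  -- grow.
  have hw : f (attachVertex o' c) ≤ f' (attachVertex o c) := by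
    have hoo := (hao o).2 rfl
    cases c with
    | none =>
      change X o' ≤ X (m.succAbove o)
      rw [hoo]
    | some j =>
      have h1 := hint o' j
      have h2 := hint' o j
      have h3 := hle o
      rw [hoo] at h3
      rw [if_pos (show Sum.inr (o', j) = attachVertex o' (some j) from rfl)] at h1
      rw [if_pos (show Sum.inr (o, j) = attachVertex o (some j) from rfl)] at h2
      refine le_of_mul_le_mul_left ?_ hr1
      change (r + 1) * f (Sum.inr (o', j)) ≤ (r + 1) * f' (Sum.inr (o, j))
      linarith
  have hy : ∀ v, 0 < y v := by
    rintro ((i | ⟨i, j⟩) | v)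
    · exact hX _
    · refine div_pos ?_ hr1
      have := hS0 (m.succAbove i)
      have := hle i
      dsimp only
      split_ifs <;> linarith
    · exact hx _
  have hjun' : ∀ i, ((k : ℝ) - 1) *
      (edgeWeightMatrix (lollipopEdge g k s (attachVertex o c)) k).mulVec y (Sum.inl (Sum.inl i)) -
        r * y (Sum.inl (Sum.inl i)) = (S' i - S (m.succAbove i)) +
          (S' ((finRotate g).symm i) - S ((finRotate (g + 1)).symm (m.succAbove i))) := by
    intro i
    have h := mulVec_junction y (attachVertex o c) hg hk hs i
    have h' := hjun (m.succAbove i)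
    simp only [hao] at h'
    rw [ite_inl_eq_attachVertex] at h
    change _ = cycleSum f' i + cycleSum f' ((finRotate g).symm i) - 2 * X (m.succAbove i) +
      (if i = o then c.elim P fun _ => 0 else 0) at h
    rw [hsum, hsum] at h
    change _ - r * X (m.succAbove i) = _
    linear_combination h - h'
  have hle'' : ∀ i, S ((finRotate (g + 1)).symm (m.succAbove i)) ≤ S' ((finRotate g).symm i) := by
    intro i
    have := hle' ((finRotate g).symm i)
    rwa [Equiv.apply_symm_apply] at this
  have hsub : ∀ v, ρ * y v ≤
      (edgeWeightMatrix (lollipopEdge g k s (attachVertex o c)) k).mulVec y v := by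
    intro v
    refine le_of_mul_le_mul_left ?_ hk1
    rw [← mul_assoc]
    change r * y v ≤ _
    rcases v with ((i | ⟨i, j⟩) | v)
    · linarith [hjun' i, hle i, hle'' i]
    · rw [mulVec_interior y (attachVertex o c) hg hk hs i j]
      change r * f' (Sum.inr (i, j)) ≤ cycleSum f' i - f' (Sum.inr (i, j)) +
        if Sum.inr (i, j) = attachVertex o c then P else 0
      rw [hsum]
      linarith [hint' i j]
    · have h := mulVec_inr x (attachVertex o' c) hk v
      rw [hmul] at h
      rw [mulVec_inr y (attachVertex o c) hk v]
      change r * x (Sum.inr v) ≤ pathRow (f' (attachVertex o c)) q v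
      rw [h]
      exact pathRow_mono hw q v
  have hstrict : ∃ i, 0 < (S' i - S (m.succAbove i)) +
      (S' ((finRotate g).symm i) - S ((finRotate (g + 1)).symm (m.succAbove i))) := by
    -- The strict gain appears at one of the two former neighbours of `m`: junction `a` if the edge
    -- before `m` gains, its successor if edge `m` does.
    rcases hlt with h | h
    · exact ⟨a, by linarith [hle'' a]⟩
    · refine ⟨finRotate g a, ?_⟩
      have := hle (finRotate g a)
      rw [Equiv.symm_apply_apply, hac', Equiv.symm_apply_apply]
      rw [hac'] at this
      linarith
  obtain ⟨i, hi⟩ := hstrict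
  have hρR : ρ < R := by
    refine edgeWeightMatrix_isSymm.lt_of_subinvariant hz hzR hy hsub (i₀ := Sum.inl (Sum.inl i)) ?_
    refine lt_of_mul_lt_mul_left ?_ hk1.le
    rw [← mul_assoc]
    change r * y _ < _
    linarith [hjun' i]
  have hρ : 0 ≤ ρ := by
    have h := congrFun hxρ (Sum.inl (Sum.inl o'))
    have h' : 0 ≤ (ρ • x) (Sum.inl (Sum.inl o')) := by
      rw [← h]
      exact Finset.sum_nonneg fun j _ => mul_nonneg (edgeWeightMatrix_nonneg hk _ _) (hx j).le
    exact nonneg_of_mul_nonneg_left h' (hx _)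
  exact (ENNReal.ofReal_lt_ofReal_iff (hρ.trans_lt hρR)).2 hρR

end Hypergraph

theorem theorem1p5 (g k s : ℕ) (hg : 2 ≤ g) (hk : 3 ≤ k) (hs : 1 ≤ s) :
    (Hypergraph.lollipop₁ (g + 1) k s (hg.trans g.le_succ)).rho <
        (Hypergraph.lollipop₁ g k s hg).rho ∧
      (Hypergraph.lollipop₂ (g + 1) k s (hg.trans g.le_succ) hk).rho <
        (Hypergraph.lollipop₂ g k s hg hk).rho :=
  ⟨Hypergraph.rho_attachHyperpath_lt hg hk hs none ⟨0, by omega⟩ ⟨0, by omega⟩ rfl rfl,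
    Hypergraph.rho_attachHyperpath_lt hg hk hs (some ⟨0, by omega⟩) ⟨0, by omega⟩ ⟨0, by omega⟩
      rfl rfl⟩
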